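/- Let $\mathfrak H$ be a complex Hilbert space with inner product $(\cdot,\cdot)$, let $J$ be a fundamental symmetry of $\mathfrak H$ (that is, $J=J^*$, $J^2=I$), and let $[x,y]_J=(Jx,y)$. Let $S$ be a densely defined symmetric operator in $\mathfrak H$ with $SJ=JS$ (equalities of operators include equality of domains). A bounded operator $C$ on $\mathfrak H$ *realizes the property of $C$-symmetry* for an operator $A$ if $C^2=I$, $JC>0$ and $AC=CA$. Let $\{C_\alpha\}_{\alpha\in D}$ be the collection of all operators $C$ that realize this property for $S$; it contains $J$, and each $C_\alpha$ maps $\mathcal D(S^*)$ into itself. Let $\Sigma_J^{\mathsf{st}}$ be the set of all operators $A\supset S$ with $A^*J=JA$ such that some $C_\alpha$ realizes the property of $C$-symmetry for $A$. Let $(\mathcal H,\Gamma_0,\Gamma_1)$ be a boundary triplet of $S^*$: $\mathcal H$ is a Hilbert space, and $\Gamma_0,\Gamma_1:\mathcal D(S^*)\to\mathcal H$ are linear maps such that $$(S^*x,y)-(x,S^*y)=(\Gamma_1x,\Gamma_0y)_{\mathcal H}-(\Gamma_0x,\Gamma_1y)_{\mathcal H},\qquad x,y\in\mathcal D(S^*),$$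 and $(\Gamma_0,\Gamma_1):\mathcal D(S^*)\to\mathcal H\oplus\mathcal H$ is surjective. Suppose that for every $\alpha\in D$ there is a linear operator $\mathcal C_\alpha$ on $\mathcal H$ with $$\mathcal C_\alpha\Gamma_0f=\Gamma_0C_\alpha f,\qquad \mathcal C_\alpha\Gamma_1f=\Gamma_1C_\alpha f,\qquad f\in\mathcal D(S^*).$$ Let $\mathcal J$ be the operator $\mathcal C_\alpha$ that corresponds to $C_\alpha=J$, and put $\Omega_\pm=\frac1{\sqrt2}(\Gamma_1\pm i\Gamma_0)$. Then $\mathcal J$ is bounded, $\mathcal J=\mathcal J^*$ and $\mathcal J^2=I$, so that $\mathcal H$ with $[x,y]_{\mathcal J}=(\mathcal Jx,y)_{\mathcal H}$ is a Krein space, and for every $A\in\Sigma_J^{\mathsf{st}}$ there is a stable $\mathcal J$-unitary operator $\mathcal K$ on $\mathcal H$ such that $$A=S^*\upharpoonright\{f\in\mathcal D(S^*)\;:\;\mathcal K\Omega_+f=\Omega_-f\}.$$ Here $\mathcal K$ is *$\mathcal J$-unitary* if it is bounded with a bounded everywhere defined inverse and $[\mathcal Kx,\mathcal Ky]_{\mathcal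 J}=[x,y]_{\mathcal J}$ for all $x,y\in\mathcal H$; it is *stable* if moreover $\sup_{n\in\mathbb Z}\|\mathcal K^n\|<\infty$. -/

import Mathlib

namespace KreinExtension

section Operators

variable {E : Type*} [NormedAddCommGroup E] [InnerProductSpace ℂ E] [CompleteSpace E]

/-- A fundamental symmetry of a Hilbert space: `J = J*` and `J² = I`. -/
def IsFundamentalSymmetry (J : E →L[ℂ] E) : Prop :=
  IsSelfAdjoint J ∧ J ∘L J = ContinuousLinearMap.id ℂ E

/-- The indefinite inner product `[x, y]_J = (J x, y)`. -/
noncomputable def indefInner (J : E →L[ℂ] E) (x y : E) : ℂ :=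
  inner ℂ (J x) y

/-- `T > 0` for a bounded operator `T`: it is self-adjoint and `(T x, x) > 0` for `x ≠ 0`. -/
def IsStrictlyPos (T : E →L[ℂ] E) : Prop :=
  T.IsPositive ∧ ∀ x : E, x ≠ 0 → 0 < (inner ℂ (T x) x).re

/-- `A C = C A` as an equality of (in general unbounded) operators, for `C` everywhere defined.
The domain of `A C` is `{x | C x ∈ D(A)}`, and the domain of `C A` is `D(A)`. -/
def Commutes (A : E →ₗ.[ℂ] E) (C : E →L[ℂ] E) : Prop :=
  (∀ x : E, C x ∈ A.domain ↔ x ∈ A.domain) ∧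
    ∀ x y : A.domain, (y : E) = C x → A y = C (A x)

/-- `A` (densely defined) is `J`-self-adjoint: `A* J = J A` as an equality of operators.
The domain of `A* J` is `{x | J x ∈ D(A*)}`, and the domain of `J A` is `D(A)`. -/
def IsJSelfAdjoint (J : E →L[ℂ] E) (A : E →ₗ.[ℂ] E) : Prop :=
  Dense (A.domain : Set E) ∧
    (∀ x : E, J x ∈ A.adjoint.domain ↔ x ∈ A.domain) ∧
      ∀ (x : A.domain) (y : A.adjoint.domain), (y : E) = J x → A.adjoint y = J (A x)

/-- The property of `C`-symmetry of `A`, in the Krein space given by `J`, realized by `C`. -/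
def HasCSymmetry (J : E →L[ℂ] E) (A : E →ₗ.[ℂ] E) (C : E →L[ℂ] E) : Prop :=
  C ∘L C = ContinuousLinearMap.id ℂ E ∧ IsStrictlyPos (J ∘L C) ∧ Commutes A C

/-- The collection `{C_α}` of all operators that realize the property of `C`-symmetry for `S`. -/
def cSymmetries (J : E →L[ℂ] E) (S : E →ₗ.[ℂ] E) : Set (E →L[ℂ] E) :=
  {C | HasCSymmetry J S C}

/-- `Σ_J`: the `J`-self-adjoint extensions of `S`. -/
def sigmaJ (J : E →L[ℂ] E) (S : E →ₗ.[ℂ] E) : Set (E →ₗ.[ℂ] E) :=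
  {A | S ≤ A ∧ IsJSelfAdjoint J A}

/-- `Σ_J^st`: the `J`-self-adjoint extensions of `S` with stable `C`-symmetry, that is, those
whose property of `C`-symmetry is realized by one of the `C`-symmetries of `S`. -/
def sigmaJStable (J : E →L[ℂ] E) (S : E →ₗ.[ℂ] E) : Set (E →ₗ.[ℂ] E) :=
  {A | A ∈ sigmaJ J S ∧ ∃ C ∈ cSymmetries J S, HasCSymmetry J A C}

/-- `K` is unitary in the Krein space given by `J`: a bounded and boundedly invertible operator
that preserves the indefinite inner product. -/
def IsJUnitary (J : E →L[ℂ] E) (K : E ≃L[ℂ] E) : Prop :=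
  ∀ x y : E, indefInner J (K x) (K y) = indefInner J x y

/-- `K` is a stable `J`-unitary operator: its integer powers are uniformly bounded. -/
def IsStableJUnitary (J : E →L[ℂ] E) (K : E ≃L[ℂ] E) : Prop :=
  IsJUnitary J K ∧ ∃ M : ℝ, ∀ n : ℤ, ‖((K ^ n : E ≃L[ℂ] E) : E →L[ℂ] E)‖ ≤ M

end Operators

/-- A boundary triplet `(H, Γ₀, Γ₁)` of `S*`: the abstract Green identity holds, and
`(Γ₀, Γ₁) : D(S*) → H ⊕ H` is surjective. -/
structure BoundaryTriplet {E : Type*} [NormedAddCommGroup E] [InnerProductSpace ℂ E]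
    [CompleteSpace E] (S : E →ₗ.[ℂ] E)
    (H : Type*) [NormedAddCommGroup H] [InnerProductSpace ℂ H] where
  /-- the boundary map `Γ₀` -/
  Γ₀ : S.adjoint.domain →ₗ[ℂ] H
  /-- the boundary map `Γ₁` -/
  Γ₁ : S.adjoint.domain →ₗ[ℂ] H
  green : ∀ x y : S.adjoint.domain,
    inner ℂ (S.adjoint x) (y : E) - inner ℂ (x : E) (S.adjoint y) =
      inner ℂ (Γ₁ x) (Γ₀ y) - inner ℂ (Γ₀ x) (Γ₁ y)
  surjective : Function.Surjective fun x : S.adjoint.domain => (Γ₀ x, Γ₁ x)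

namespace BoundaryTriplet

variable {E : Type*} [NormedAddCommGroup E] [InnerProductSpace ℂ E] [CompleteSpace E]
  {S : E →ₗ.[ℂ] E} {H : Type*} [NormedAddCommGroup H] [InnerProductSpace ℂ H]

/-- `Ω₊ = (Γ₁ + i Γ₀) / √2`. -/
noncomputable def omegaPlus (Γ : BoundaryTriplet S H) : S.adjoint.domain →ₗ[ℂ] H :=
  ((1 / Real.sqrt 2 : ℝ) : ℂ) • (Γ.Γ₁ + Complex.I • Γ.Γ₀)

/-- `Ω₋ = (Γ₁ - i Γ₀) / √2`. -/
noncomputable def omegaMinus (Γ : BoundaryTriplet S H) : S.adjoint.domain →ₗ[ℂ] H :=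
  ((1 / Real.sqrt 2 : ℝ) : ℂ) • (Γ.Γ₁ - Complex.I • Γ.Γ₀)

/-- The operator `c` in `H` is the image of `C` under the triplet: `c Γ₀ f = Γ₀ C f` and
`c Γ₁ f = Γ₁ C f` for `f ∈ D(S*)`. Here `g` stands for `C f`, as an element of `D(S*)`; it exists
for every `f` whenever `C` is one of the `C`-symmetries of `S`, by `map_mem_adjoint_domain`. -/
def IsImage (Γ : BoundaryTriplet S H) (C : E →L[ℂ] E) (c : H →ₗ[ℂ] H) : Prop :=
  ∀ f g : S.adjoint.domain, (g : E) = C f → c (Γ.Γ₀ f) = Γ.Γ₀ g ∧ c (Γ.Γ₁ f) = Γ.Γ₁ g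

/-- The triplet intertwines the `C`-symmetries: each `C`-symmetry of `S` has an image in `H`. -/
def IntertwinesCSymmetries (Γ : BoundaryTriplet S H) (J : E →L[ℂ] E) : Prop :=
  ∀ C ∈ cSymmetries J S, ∃ c : H →ₗ[ℂ] H, Γ.IsImage C c

/-- The restriction of `S*` to `{f ∈ D(S*) | K Ω₊ f = Ω₋ f}`. -/
noncomputable def extension (Γ : BoundaryTriplet S H) (K : H →L[ℂ] H) : E →ₗ.[ℂ] E :=
  S.adjoint.domRestrict
    ((LinearMap.eqLocus ((K : H →ₗ[ℂ] H) ∘ₗ Γ.omegaPlus) Γ.omegaMinus).map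
      S.adjoint.domain.subtype)

end BoundaryTriplet

/-- The `C`-symmetries of a densely defined operator `S` that commutes with the fundamental
symmetry `J` leave the domain of `S*` invariant. -/
theorem map_mem_adjoint_domain {E : Type*} [NormedAddCommGroup E] [InnerProductSpace ℂ E]
    [CompleteSpace E] {J : E →L[ℂ] E} (hJ : IsFundamentalSymmetry J) {S : E →ₗ.[ℂ] E}
    (hS : Dense (S.domain : Set E)) (hSJ : Commutes S J) {C : E →L[ℂ] E}
    (hC : C ∈ cSymmetries J S) {f : E} (hf : f ∈ S.adjoint.domain) :
    C f ∈ S.adjoint.domain := by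
  obtain ⟨_, ⟨hpos, _⟩, hcomm⟩ := hC
  have hJJ : ∀ x, J (J x) = x := fun x => by
    simpa using congrArg (fun T : E →L[ℂ] E => T x) hJ.2
  have hJs : ∀ x y, inner ℂ (J x) y = inner ℂ x (J y) := fun x y => by
    rw [← ContinuousLinearMap.adjoint_inner_right, hJ.1.adjoint_eq]
  have hJC : ∀ x y, inner ℂ (J (C x)) y = inner ℂ x (J (C y)) := fun x y => by
    have h := hpos.isSelfAdjoint
    have h2 := ContinuousLinearMap.adjoint_inner_right (J ∘L C) x y
    rw [h.adjoint_eq] at h2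
    simpa using h2.symm
  -- `C* = J C J` maps `D(S)` to itself and commutes with `S` there
  have hadj : ∀ x y, inner ℂ (C x) y = inner ℂ x (J (C (J y))) := fun x y => by
    rw [← hJC, hJs, hJJ]
  let y : S.adjoint.domain := ⟨f, hf⟩
  apply LinearPMap.mem_adjoint_domain_of_exists
  refine ⟨C (S.adjoint y), fun x => ?_⟩
  have h1 : J x ∈ S.domain := (hSJ.1 x).2 x.2
  have h2 : C (J x) ∈ S.domain := (hcomm.1 _).2 h1
  have h3 : J (C (J x)) ∈ S.domain := (hSJ.1 _).2 h2
  have e : S ⟨J (C (J x)), h3⟩ = J (C (J (S x))) := by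
    rw [hSJ.2 ⟨_, h2⟩ ⟨_, h3⟩ rfl, hcomm.2 ⟨_, h1⟩ ⟨_, h2⟩ rfl, hSJ.2 x ⟨_, h1⟩ rfl]
  have h4 := LinearPMap.adjoint_isFormalAdjoint hS y ⟨J (C (J x)), h3⟩
  rw [hadj, hadj, ← e]
  exact h4

end KreinExtension

/-!
Fix `A ∈ Σ_J^st` whose `C`-symmetry is realized by `C`, put `G = J C`, and let `c`, `𝓙`, `g = 𝓙 c`
be the images of `C`, `J`, `G` in the boundary space `H`. The relation `A* J = J A` together with
`A C = C A` says that `A` is self-adjoint for the inner product `(G ·, ·)`, and `S` is symmetric for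
it. With respect to this inner product and to `(g ·, ·)` on `H`, the maps `Γ₀, Γ₁` again satisfy a
Green identity, so the usual description of self-adjoint extensions yields an operator `K` that is
unitary for `(g ·, ·)` with `D(A) = {f | K Ω₊ f = Ω₋ f}`. As `(g ·, ·)` is equivalent to the inner
product of `H`, the powers of `K` are uniformly bounded. As `A` commutes with `C`, `K` commutes with
`c`, and `𝓙 = g c`, so `K` is `𝓙`-unitary.

The images are bounded because the Green identity makes `𝓙` and `g` symmetric and everywhere
defined (Hellinger–Toeplitz). The step that is not algebraic is that `g` is positive
(`BoundaryTriplet.isPositive_of_isImage`). The bounded operators that preserve, together with their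
adjoints, the closed graph of `S*` form a closed star subalgebra, which therefore contains
`(G + t)⁻¹` for `t > 0`; lifting a vector of `H` to `D(S*)` and applying `(G + t)⁻¹` there shows
that `g + t` is surjective, so the spectrum of the self-adjoint operator `g` lies in `[0, ∞)`.

`BoundaryTriplet.mem_domain_iff` identifies `D(A)` by its boundary values, and
`exists_unitary_of_isHypermaximal` produces `K`.
-/

namespace KreinExtension

open ContinuousLinearMap

section Operators

/-! ### Fundamental symmetries and C-symmetries -/

variable {E : Type*} [NormedAddCommGroup E] [InnerProductSpace ℂ E]

theorem HasCSymmetry.apply_apply {J C : E →L[ℂ] E} {A : E →ₗ.[ℂ] E} (hC : HasCSymmetry J A C)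
    (x : E) : C (C x) = x := by
  simpa using congrArg (fun T : E →L[ℂ] E => T x) hC.1

theorem HasCSymmetry.isPositive {J C : E →L[ℂ] E} {A : E →ₗ.[ℂ] E} (hC : HasCSymmetry J A C) :
    (J ∘L C).IsPositive :=
  hC.2.1.1

theorem Commutes.mem_graph {B : E →ₗ.[ℂ] E} {T : E →L[ℂ] E} (h : Commutes B T) :
    ∀ p ∈ B.graph, (T p.1, T p.2) ∈ B.graph := by
  rintro ⟨x, y⟩ hp
  obtain ⟨u, hu, hy⟩ := (LinearPMap.mem_graph_iff _).1 hp
  subst hu hy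
  have h1 : T u ∈ B.domain := (h.1 _).2 u.2
  exact (LinearPMap.mem_graph_iff _).2 ⟨⟨_, h1⟩, rfl, h.2 u ⟨_, h1⟩ rfl⟩

variable [CompleteSpace E]

theorem inner_apply_of_isSelfAdjoint {T : E →L[ℂ] E} (hT : IsSelfAdjoint T) (x y : E) :
    inner ℂ (T x) y = inner ℂ x (T y) := by
  rw [← adjoint_inner_right, hT.adjoint_eq]

theorem IsFundamentalSymmetry.apply_apply {J : E →L[ℂ] E} (hJ : IsFundamentalSymmetry J) (x : E) :
    J (J x) = x := by
  simpa using congrArg (fun T : E →L[ℂ] E => T x) hJ.2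

/-- The fundamental symmetry is itself a `C`-symmetry of `S`. -/
theorem mem_cSymmetries_self {J : E →L[ℂ] E} (hJ : IsFundamentalSymmetry J) {S : E →ₗ.[ℂ] E}
    (hSJ : Commutes S J) : J ∈ cSymmetries J S := by
  refine ⟨hJ.2, ⟨?_, fun x hx => ?_⟩, hSJ⟩
  · rw [hJ.2]
    exact isPositive_one
  · rw [hJ.2, ContinuousLinearMap.id_apply, inner_self_eq_norm_sq_to_K]
    exact_mod_cast pow_pos (norm_pos_iff.2 hx) 2

theorem adjoint_eq_of_isSelfAdjoint_comp {J C : E →L[ℂ] E} (hJ : IsFundamentalSymmetry J)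
    (hJC : IsSelfAdjoint (J ∘L C)) : adjoint C = J ∘L C ∘L J := by
  refine ((eq_adjoint_iff _ _).2 fun x y => ?_).symm
  have h := inner_apply_of_isSelfAdjoint hJC (J x) y
  simp only [comp_apply] at h ⊢
  rw [h, inner_apply_of_isSelfAdjoint hJ.1, hJ.apply_apply]

/-- If `T*` commutes with `S` on `D(S)`, then `T` commutes with `S*` on `D(S*)`. -/
theorem mem_graph_adjoint {S : E →ₗ.[ℂ] E} (hS : Dense (S.domain : Set E)) {T : E →L[ℂ] E}
    (hT : ∀ p ∈ S.graph, (adjoint T p.1, adjoint T p.2) ∈ S.graph) :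
    ∀ p ∈ S.adjoint.graph, (T p.1, T p.2) ∈ S.adjoint.graph := by
  rintro ⟨x, y⟩ hp
  obtain ⟨u, hu, hy⟩ := (LinearPMap.mem_graph_iff _).1 hp
  subst hu hy
  have key : ∀ v : S.domain, inner ℂ (T (S.adjoint u)) (v : E) = inner ℂ (T u) (S v) := by
    intro v
    obtain ⟨w, hw, hw'⟩ := (LinearPMap.mem_graph_iff _).1 (hT _ (S.mem_graph v))
    rw [← adjoint_inner_right, ← adjoint_inner_right]
    change inner ℂ _ (adjoint T v) = inner ℂ _ (adjoint T (S v))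
    rw [show adjoint T (v : E) = w from hw.symm, show adjoint T (S v) = S w from hw'.symm]
    exact LinearPMap.adjoint_isFormalAdjoint hS u w
  have h1 : T u ∈ S.adjoint.domain := LinearPMap.mem_adjoint_domain_of_exists _ ⟨_, key⟩
  exact (LinearPMap.mem_graph_iff _).2 ⟨⟨_, h1⟩, rfl, LinearPMap.adjoint_apply_eq hS _ key⟩

/-- The bounded operators `T` such that `T` and `T*` commute with `B` on the domain of `B`,
expressed as invariance of the graph of `B` under `T ⊕ T` and `T* ⊕ T*`. -/
noncomputable def graphSubalgebra (B : E →ₗ.[ℂ] E) : StarSubalgebra ℂ (E →L[ℂ] E) where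
  carrier := {T | ∀ p ∈ B.graph, (T p.1, T p.2) ∈ B.graph ∧
    (adjoint T p.1, adjoint T p.2) ∈ B.graph}
  mul_mem' {a b} ha hb p hp := by
    refine ⟨(ha _ (hb p hp).1).1, ?_⟩
    change (adjoint (a ∘L b) p.1, adjoint (a ∘L b) p.2) ∈ B.graph
    rw [adjoint_comp]
    exact (hb _ (ha p hp).2).2
  add_mem' {a b} ha hb p hp := by
    rw [map_add]
    exact ⟨B.graph.add_mem (ha p hp).1 (hb p hp).1, B.graph.add_mem (ha p hp).2 (hb p hp).2⟩
  algebraMap_mem' r p hp := by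
    rw [← star_eq_adjoint, ← algebraMap_star_comm]
    simp only [Algebra.algebraMap_eq_smul_one]
    exact ⟨B.graph.smul_mem r hp, B.graph.smul_mem _ hp⟩
  star_mem' {a} ha p hp := by
    rw [star_eq_adjoint, adjoint_adjoint]
    exact (ha p hp).symm

theorem mem_graphSubalgebra {B : E →ₗ.[ℂ] E} {T : E →L[ℂ] E} :
    T ∈ graphSubalgebra B ↔ ∀ p ∈ B.graph, (T p.1, T p.2) ∈ B.graph ∧
      (adjoint T p.1, adjoint T p.2) ∈ B.graph :=
  Iff.rfl

theorem isClosed_graphSubalgebra {B : E →ₗ.[ℂ] E} (hB : B.IsClosed) :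
    IsClosed (graphSubalgebra B : Set (E →L[ℂ] E)) := by
  have h : (graphSubalgebra B : Set (E →L[ℂ] E)) = ⋂ p ∈ B.graph,
      {T | (T p.1, T p.2) ∈ B.graph} ∩ {T | (adjoint T p.1, adjoint T p.2) ∈ B.graph} := by
    ext T
    simp [mem_graphSubalgebra]
  rw [h]
  refine isClosed_biInter fun p _ => ?_
  have hc (v : E) : Continuous fun T : E →L[ℂ] E => adjoint T v :=
    (ContinuousLinearMap.apply ℂ E v).continuous.comp adjoint.continuous
  refine (IsClosed.preimage ?_ hB).inter (IsClosed.preimage ?_ hB)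
  · fun_prop
  · exact (hc _).prodMk (hc _)

theorem apply_mem_of_mem_graphSubalgebra {B : E →ₗ.[ℂ] E} {T : E →L[ℂ] E}
    (hT : T ∈ graphSubalgebra B) {x : E} (hx : x ∈ B.domain) : T x ∈ B.domain :=
  LinearPMap.mem_domain_of_mem_graph (hT _ (B.mem_graph ⟨x, hx⟩)).1

theorem map_apply_of_mem_graphSubalgebra {B : E →ₗ.[ℂ] E} {T : E →L[ℂ] E}
    (hT : T ∈ graphSubalgebra B) (x y : B.domain) (hy : (y : E) = T x) : B y = T (B x) := by
  have h := (hT _ (B.mem_graph x)).1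
  rw [← hy] at h
  exact B.mem_graph_snd_inj (B.mem_graph y) h rfl

theorem mem_graphSubalgebra_adjoint {J : E →L[ℂ] E} (hJ : IsFundamentalSymmetry J)
    {S : E →ₗ.[ℂ] E} (hS : Dense (S.domain : Set E)) (hSJ : Commutes S J) {C : E →L[ℂ] E}
    (hC : C ∈ cSymmetries J S) : C ∈ graphSubalgebra S.adjoint := by
  have hadj := adjoint_eq_of_isSelfAdjoint_comp hJ hC.isPositive.isSelfAdjoint
  have h1 := hSJ.mem_graph
  have h2 := hC.2.2.mem_graph
  refine fun p hp => ⟨mem_graph_adjoint hS ?_ p hp, mem_graph_adjoint hS ?_ p hp⟩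
  · rw [hadj]
    exact fun q hq => h1 _ (h2 _ (h1 _ hq))
  · rw [adjoint_adjoint]
    exact h2

/-- For a positive operator `G` commuting with `B`, the resolvent `(G + t)⁻¹` preserves `D(B)`;
equivalently, every element of `D(B)` is `(G + t) h` with `h ∈ D(B)`. -/
theorem exists_add_smul_eq {B : E →ₗ.[ℂ] E} (hB : B.IsClosed) {G : E →L[ℂ] E}
    (hG : G ∈ graphSubalgebra B) (hpos : G.IsPositive) {t : ℝ} (ht : 0 < t) {f : E}
    (hf : f ∈ B.domain) : ∃ h ∈ B.domain, G h + (t : ℂ) • h = f := by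
  let Q := G + algebraMap ℂ (E →L[ℂ] E) (t : ℂ)
  have hQx (x : E) : Q x = G x + (t : ℂ) • x := by
    simp [Q, Algebra.algebraMap_eq_smul_one]
  have hQ : IsUnit Q := by
    refine isUnit_of_forall_le_norm_inner_map Q (c := ⟨t, ht.le⟩) ht fun x => ?_
    refine le_trans ?_ (Complex.abs_re_le_norm _)
    refine le_trans ?_ (le_abs_self _)
    have h1 : 0 ≤ (inner ℂ (G x) x).re := hpos.re_inner_nonneg_left x
    have h2 : (inner ℂ ((t : ℂ) • x) x).re = t * ‖x‖ ^ 2 := by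
      rw [inner_smul_left, inner_self_eq_norm_sq_to_K, Complex.conj_ofReal,
        ← RCLike.ofReal_pow]
      exact Complex.re_ofReal_mul t _
    rw [hQx, inner_add_left, Complex.add_re, h2, mul_comm]
    exact le_add_of_nonneg_left h1
  have hcl := isClosed_graphSubalgebra hB
  obtain ⟨u, hu⟩ := ((graphSubalgebra B).coe_isUnit (hS := hcl)
    (a := ⟨Q, add_mem hG (algebraMap_mem _ _)⟩)).1 hQ
  refine ⟨(u⁻¹ : (graphSubalgebra B)ˣ).1.1 f,
    apply_mem_of_mem_graphSubalgebra (u⁻¹ : (graphSubalgebra B)ˣ).1.2 hf, ?_⟩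
  rw [← hQx]
  have h := congrArg (fun T : graphSubalgebra B => T.1 f) u.mul_inv
  simpa [hu] using h

/-- A `J`-self-adjoint extension of `S` is a restriction of `S*`. -/
theorem le_adjoint_of_mem_sigmaJ {J : E →L[ℂ] E} (hJ : IsFundamentalSymmetry J) {S : E →ₗ.[ℂ] E}
    (hS : Dense (S.domain : Set E)) (hSJ : Commutes S J) {A : E →ₗ.[ℂ] E} (hA : A ∈ sigmaJ J S) :
    A ≤ S.adjoint := by
  obtain ⟨hSA, hAd, hdom, hval⟩ := hA
  have hJS := mem_graphSubalgebra_adjoint hJ hS hSJ (mem_cSymmetries_self hJ hSJ)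
  refine LinearPMap.le_of_le_graph ?_
  rintro ⟨x, y⟩ hp
  obtain ⟨u, hu, hy⟩ := (LinearPMap.mem_graph_iff _).1 hp
  subst hu hy
  have h1 : J u ∈ A.adjoint.domain := (hdom _).2 u.2
  have key (v : S.domain) : inner ℂ (J (A u)) (v : E) = inner ℂ (J u) (S v) := by
    have h2 := LinearPMap.adjoint_isFormalAdjoint hAd ⟨_, h1⟩ ⟨v, hSA.1 v.2⟩
    rwa [hval u ⟨_, h1⟩ rfl, ← hSA.2 (x := v) (y := ⟨v, hSA.1 v.2⟩) rfl] at h2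
  have h3 : J u ∈ S.adjoint.domain := LinearPMap.mem_adjoint_domain_of_exists _ ⟨_, key⟩
  have h4 := (hJS _ (S.adjoint.mem_graph ⟨_, h3⟩)).1
  rw [LinearPMap.adjoint_apply_eq hS ⟨_, h3⟩ key] at h4
  simpa only [hJ.apply_apply] using h4

/-! ### Operators that are unitary for an equivalent inner product -/

/-- A positive invertible operator is bounded below by a positive multiple of the identity. -/
theorem exists_pos_le_inner {g : E →L[ℂ] E} (hg : g.IsPositive) (hu : IsUnit g) :
    ∃ δ : ℝ, 0 < δ ∧ ∀ x, δ * ‖x‖ ^ 2 ≤ (inner ℂ x (g x)).re := by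
  rcases subsingleton_or_nontrivial E with hE | hE
  · exact ⟨1, one_pos, fun x => by simp [Subsingleton.elim x 0]⟩
  have h0 : IsStrictlyPositive g := hu.isStrictlyPositive ((nonneg_iff_isPositive g).2 hg)
  obtain ⟨δ, hδ, hle⟩ := (CFC.exists_pos_algebraMap_le_iff h0.isSelfAdjoint).2
    fun x hx => h0.spectrum_pos (𝕜 := ℝ) hx
  refine ⟨δ, hδ, fun x => ?_⟩
  have h1 : 0 ≤ (inner ℂ x ((g - algebraMap ℝ (E →L[ℂ] E) δ) x)).re :=
    ((le_def _ _).1 hle).re_inner_nonneg_right x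
  have h2 : (algebraMap ℝ (E →L[ℂ] E) δ) x = (δ : ℂ) • x := by
    simp [Algebra.algebraMap_eq_smul_one]
  have h3 : (inner ℂ x ((δ : ℂ) • x)).re = δ * ‖x‖ ^ 2 := by
    rw [inner_smul_right, inner_self_eq_norm_sq_to_K, ← RCLike.ofReal_pow]
    exact Complex.re_ofReal_mul δ _
  rw [sub_apply, h2, inner_sub_right, Complex.sub_re, h3] at h1
  linarith

/-- The first coordinate of a relation `L` that is its own orthogonal complement for the form
`(p, g p') - (q, g q')` runs bijectively through `E`: since `(p, g p) = (q, g q)` on `L`, it bounds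
the second coordinate, and a vector orthogonal to its range vanishes by maximality of `L`. -/
theorem bijective_fst_of_isHypermaximal {g : E →L[ℂ] E} (hg : g.IsPositive) (hu : IsUnit g)
    {L : Submodule ℂ (E × E)} (hc : IsClosed (L : Set (E × E)))
    (hL : ∀ p q, (p, q) ∈ L ↔ ∀ z ∈ L, inner ℂ p (g z.1) = inner ℂ q (g z.2)) :
    Function.Bijective ((ContinuousLinearMap.fst ℂ E E).comp L.subtypeL) := by
  obtain ⟨δ, hδ, hle⟩ := exists_pos_le_inner hg hu
  have : CompleteSpace L := hc.completeSpace_coe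
  rw [bijective_iff_dense_range_and_antilipschitz]
  constructor
  · rw [Submodule.topologicalClosure_eq_top_iff, Submodule.eq_bot_iff]
    intro v hv
    obtain ⟨w, rfl⟩ := (isUnit_iff_bijective.1 hu).2 v
    -- `v = g w` is orthogonal to the range, so `(w, 0)` lies in `L` and is orthogonal to itself
    have hw : (w, (0 : E)) ∈ L := by
      refine (hL _ _).2 fun z hz => ?_
      rw [inner_zero_left, ← inner_apply_of_isSelfAdjoint hg.isSelfAdjoint]
      exact Submodule.inner_left_of_mem_orthogonal (K := LinearMap.range _) ⟨⟨z, hz⟩, rfl⟩ hv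
    have h1 := (hL _ _).1 hw _ hw
    have h2 := hle w
    simp only [map_zero, inner_zero_right] at h1
    rw [h1, Complex.zero_re] at h2
    have h3 : ‖w‖ ^ 2 = 0 :=
      le_antisymm (nonpos_of_mul_nonpos_right h2 hδ) (sq_nonneg _)
    rw [norm_eq_zero.1 (pow_eq_zero_iff two_ne_zero |>.1 h3), map_zero]
  · have hb : 0 ≤ ‖g‖ / δ := by positivity
    refine ⟨⟨Real.sqrt (‖g‖ / δ) + 1, by positivity⟩,
      antilipschitz_of_bound _ fun z => ?_⟩
    obtain ⟨⟨p, q⟩, hz⟩ := z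
    change max ‖p‖ ‖q‖ ≤ (Real.sqrt (‖g‖ / δ) + 1) * ‖p‖
    have h1 := (hL _ _).1 hz _ hz
    have h2 := hle q
    rw [← h1] at h2
    have h3 : (inner ℂ p (g p)).re ≤ ‖g‖ * ‖p‖ ^ 2 :=
      calc _ ≤ ‖inner ℂ p (g p)‖ := Complex.re_le_norm _
        _ ≤ ‖p‖ * ‖g p‖ := norm_inner_le_norm _ _
        _ ≤ ‖p‖ * (‖g‖ * ‖p‖) := by gcongr; exact g.le_opNorm p
        _ = ‖g‖ * ‖p‖ ^ 2 := by ring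
    have h4 : ‖q‖ ≤ Real.sqrt (‖g‖ / δ) * ‖p‖ := by
      refine abs_le_of_sq_le_sq' ?_ (by positivity) |>.2
      rw [mul_pow, Real.sq_sqrt hb, div_mul_eq_mul_div, le_div_iff₀ hδ]
      linarith
    have h5 := norm_nonneg p
    have h6 := Real.sqrt_nonneg (‖g‖ / δ)
    refine max_le ?_ ?_ <;> nlinarith

/-- A relation in `E` which is its own orthogonal complement for the form
`(p, g p') - (q, g q')`, with `g` positive and invertible, is the graph of an operator that is
unitary for the inner product `(g ·, ·)`. -/
theorem exists_unitary_of_isHypermaximal {g : E →L[ℂ] E} (hg : g.IsPositive) (hu : IsUnit g)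
    {L : Submodule ℂ (E × E)}
    (hL : ∀ p q, (p, q) ∈ L ↔ ∀ z ∈ L, inner ℂ p (g z.1) = inner ℂ q (g z.2)) :
    ∃ K : E ≃L[ℂ] E, (∀ p q, (p, q) ∈ L ↔ K p = q) ∧
      ∀ x y, inner ℂ (K x) (g (K y)) = inner ℂ x (g y) := by
  have hc : IsClosed (L : Set (E × E)) := by
    have h : (L : Set (E × E)) =
        ⋂ z ∈ L, {w | inner ℂ w.1 (g z.1) = inner ℂ w.2 (g z.2)} := by
      ext ⟨p, q⟩
      simpa using hL p q
    rw [h]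
    exact isClosed_biInter fun z _ => isClosed_eq (by fun_prop) (by fun_prop)
  have : CompleteSpace L := hc.completeSpace_coe
  -- the converse relation satisfies the same hypothesis, so both projections are bijective
  let e : (E × E) ≃L[ℂ] E × E := ContinuousLinearEquiv.prodComm ℂ E E
  have hL' (p q : E) : (p, q) ∈ L.comap (e : E × E →ₗ[ℂ] E × E) ↔ (q, p) ∈ L := Iff.rfl
  have h2 := bijective_fst_of_isHypermaximal hg hu (L := L.comap (e : E × E →ₗ[ℂ] E × E))
    (hc.preimage e.continuous) fun p q => by
      rw [hL', hL]
      exact ⟨fun h z hz => (h (z.2, z.1) hz).symm, fun h z hz => (h (z.2, z.1) hz).symm⟩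
  have h1 := bijective_fst_of_isHypermaximal hg hu hc hL
  have h2 : Function.Bijective ((ContinuousLinearMap.snd ℂ E E).comp L.subtypeL) := by
    constructor
    · rintro ⟨⟨p, q⟩, hz⟩ ⟨⟨p', q'⟩, hz'⟩ h
      have := @h2.1 ⟨(q, p), hz⟩ ⟨(q', p'), hz'⟩ h
      have h' : (q, p) = (q', p') := congrArg Subtype.val this
      exact Subtype.ext (congrArg Prod.swap h')
    · intro q
      obtain ⟨⟨⟨q', p⟩, hz⟩, rfl⟩ := h2.2 q
      exact ⟨⟨(p, q'), hz⟩, rfl⟩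
  let e₁ := ContinuousLinearEquiv.ofBijective _ (LinearMap.ker_eq_bot.2 h1.1)
    (LinearMap.range_eq_top.2 h1.2)
  let e₂ := ContinuousLinearEquiv.ofBijective _ (LinearMap.ker_eq_bot.2 h2.1)
    (LinearMap.range_eq_top.2 h2.2)
  have hK (z : L) : (e₁.symm.trans e₂) (z : E × E).1 = (z : E × E).2 := by
    have h : e₁.symm (z : E × E).1 = z := e₁.symm_apply_apply z
    rw [ContinuousLinearEquiv.trans_apply, h]
    rfl
  have hmem (p q : E) : (p, q) ∈ L ↔ (e₁.symm.trans e₂) p = q := by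
    refine ⟨fun h => hK ⟨_, h⟩, ?_⟩
    rintro rfl
    obtain ⟨z, rfl⟩ := h1.2 p
    have h : (e₁.symm.trans e₂) (((ContinuousLinearMap.fst ℂ E E).comp L.subtypeL) z) =
      (z : E × E).2 := hK z
    rw [h]
    exact z.2
  exact ⟨e₁.symm.trans e₂, hmem, fun x y =>
    (((hL _ _).1 ((hmem x _).2 rfl)) _ ((hmem y _).2 rfl)).symm⟩

/-- The powers of an operator that is unitary for the equivalent inner product `(g ·, ·)` are
uniformly bounded. -/
theorem exists_norm_zpow_le {g : E →L[ℂ] E} (hg : g.IsPositive) (hu : IsUnit g) {K : E ≃L[ℂ] E}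
    (hK : ∀ x y, inner ℂ (K x) (g (K y)) = inner ℂ x (g y)) :
    ∃ M : ℝ, ∀ n : ℤ, ‖((K ^ n : E ≃L[ℂ] E) : E →L[ℂ] E)‖ ≤ M := by
  obtain ⟨δ, hδ, hle⟩ := exists_pos_le_inner hg hu
  let U : Subgroup (E ≃L[ℂ] E) :=
    { carrier := {K | ∀ x y, inner ℂ (K x) (g (K y)) = inner ℂ x (g y)}
      one_mem' := fun _ _ => rfl
      mul_mem' := fun {a b} ha hb x y => (ha (b x) (b y)).trans (hb x y)
      inv_mem' := fun {a} ha x y => by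
        have h := ha (a⁻¹ x) (a⁻¹ y)
        have hz (z : E) : a (a⁻¹ z) = z := a.apply_symm_apply z
        rw [hz, hz] at h
        exact h.symm }
  refine ⟨Real.sqrt (‖g‖ / δ), fun n => opNorm_le_bound _ (Real.sqrt_nonneg _) fun x => ?_⟩
  have hn : K ^ n ∈ U := U.zpow_mem (show K ∈ U from hK) n
  have h1 := hle ((K ^ n) x)
  rw [hn x x] at h1
  have h3 : (inner ℂ x (g x)).re ≤ ‖g‖ * ‖x‖ ^ 2 :=
    calc _ ≤ ‖inner ℂ x (g x)‖ := Complex.re_le_norm _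
      _ ≤ ‖x‖ * ‖g x‖ := norm_inner_le_norm _ _
      _ ≤ ‖x‖ * (‖g‖ * ‖x‖) := by gcongr; exact g.le_opNorm x
      _ = ‖g‖ * ‖x‖ ^ 2 := by ring
  refine abs_le_of_sq_le_sq' ?_ (by positivity) |>.2
  rw [mul_pow, Real.sq_sqrt (by positivity), div_mul_eq_mul_div, le_div_iff₀ hδ, mul_comm]
  exact h1.trans h3

end Operators

namespace BoundaryTriplet

variable {E : Type*} [NormedAddCommGroup E] [InnerProductSpace ℂ E] [CompleteSpace E]
  {S : E →ₗ.[ℂ] E} {H : Type*} [NormedAddCommGroup H] [InnerProductSpace ℂ H]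

/-! ### Images in the boundary space -/

theorem exists_eq (Γ : BoundaryTriplet S H) (a b : H) : ∃ f, Γ.Γ₀ f = a ∧ Γ.Γ₁ f = b := by
  obtain ⟨f, hf⟩ := Γ.surjective (a, b)
  exact ⟨f, congrArg Prod.fst hf, congrArg Prod.snd hf⟩

theorem IsImage.comp {Γ : BoundaryTriplet S H} {C D : E →L[ℂ] E} {c d : H →ₗ[ℂ] H}
    (hc : Γ.IsImage C c) (hd : Γ.IsImage D d) (hD : D ∈ graphSubalgebra S.adjoint) :
    Γ.IsImage (C ∘L D) (c ∘ₗ d) := by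
  intro f g hg
  have h1 := hd f ⟨D f, apply_mem_of_mem_graphSubalgebra hD f.2⟩ rfl
  have h2 := hc ⟨D f, apply_mem_of_mem_graphSubalgebra hD f.2⟩ g hg
  exact ⟨by rw [LinearMap.comp_apply, h1.1, h2.1], by rw [LinearMap.comp_apply, h1.2, h2.2]⟩

theorem IsImage.apply_apply {Γ : BoundaryTriplet S H} {C : E →L[ℂ] E} {c : H →ₗ[ℂ] H}
    (hc : Γ.IsImage C c) (hC : C ∈ graphSubalgebra S.adjoint) (hCC : ∀ x, C (C x) = x) (u : H) :
    c (c u) = u := by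
  obtain ⟨f, rfl, -⟩ := Γ.exists_eq u 0
  exact ((hc.comp hc hC) f f (hCC f).symm).1

/-- The Green identity twisted by an operator `T` that commutes with `S*`. -/
theorem IsImage.green {Γ : BoundaryTriplet S H} {T : E →L[ℂ] E} {s : H →ₗ[ℂ] H}
    (hs : Γ.IsImage T s) (hT : T ∈ graphSubalgebra S.adjoint) (x y : S.adjoint.domain) :
    inner ℂ (S.adjoint x) (T y) - inner ℂ (x : E) (T (S.adjoint y)) =
      inner ℂ (Γ.Γ₁ x) (s (Γ.Γ₀ y)) - inner ℂ (Γ.Γ₀ x) (s (Γ.Γ₁ y)) := by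
  have hy := apply_mem_of_mem_graphSubalgebra hT y.2
  have h := hs y ⟨T y, hy⟩ rfl
  rw [h.1, h.2, ← Γ.green, map_apply_of_mem_graphSubalgebra hT y ⟨T y, hy⟩ rfl]

theorem IsImage.isSymmetric {Γ : BoundaryTriplet S H} {T : E →L[ℂ] E} {s : H →ₗ[ℂ] H}
    (hs : Γ.IsImage T s) (hT : T ∈ graphSubalgebra S.adjoint) (hsa : IsSelfAdjoint T) :
    s.IsSymmetric := by
  intro u v
  obtain ⟨x, hx0, hx1⟩ := Γ.exists_eq 0 u
  obtain ⟨y, hy0, hy1⟩ := Γ.exists_eq v 0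
  have h1 := hs.green hT x y
  have h2 := hs.green hT y x
  rw [hx0, hx1, hy0, hy1] at h1 h2
  simp only [map_zero, inner_zero_right, zero_sub, sub_zero] at h1 h2
  rw [← h1, ← inner_conj_symm, ← neg_eq_iff_eq_neg.2 h2]
  simp only [map_neg, map_sub, inner_conj_symm]
  rw [inner_apply_of_isSelfAdjoint hsa, inner_apply_of_isSelfAdjoint hsa]
  ring

/-- The image of a positive operator is positive. -/
theorem isPositive_of_isImage [CompleteSpace H] {Γ : BoundaryTriplet S H}
    (hS : Dense (S.domain : Set E)) {G : E →L[ℂ] E} {g : H →L[ℂ] H}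
    (hg : Γ.IsImage G (g : H →ₗ[ℂ] H)) (hG : G ∈ graphSubalgebra S.adjoint) (hpos : G.IsPositive) :
    g.IsPositive := by
  have hsa : IsSelfAdjoint g :=
    isSelfAdjoint_iff_isSymmetric.2 (hg.isSymmetric hG hpos.isSelfAdjoint)
  rw [← nonneg_iff_isPositive, StarOrderedRing.nonneg_iff_spectrum_nonneg (R := ℝ) g]
  intro t ht
  by_contra! hneg
  refine ht ?_
  -- `g - t` is surjective because elements of `D(S*)` can be divided by `G - t` within `D(S*)`
  have happ (x : H) : (algebraMap ℝ (H →L[ℂ] H) t - g) x = (t : ℂ) • x - g x := by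
    simp [Algebra.algebraMap_eq_smul_one]
  have hsurj : Function.Surjective (algebraMap ℝ (H →L[ℂ] H) t - g) := by
    intro u
    obtain ⟨f, rfl, -⟩ := Γ.exists_eq u 0
    obtain ⟨h, hh, hf⟩ := exists_add_smul_eq (LinearPMap.adjoint_isClosed hS) hG hpos
      (neg_pos.2 hneg) f.2
    have h1 := (hg ⟨h, hh⟩ ⟨G h, apply_mem_of_mem_graphSubalgebra hG hh⟩ rfl).1
    have h2 : f = (⟨G h, apply_mem_of_mem_graphSubalgebra hG hh⟩ : S.adjoint.domain) +
        ((-t : ℝ) : ℂ) • ⟨h, hh⟩ := Subtype.ext hf.symm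
    refine ⟨-Γ.Γ₀ ⟨h, hh⟩, ?_⟩
    rw [happ, h2, map_add, map_smul, ← h1]
    simp only [coe_coe, Complex.ofReal_neg, map_neg]
    module
  refine isUnit_iff_bijective.2 ⟨?_, hsurj⟩
  rw [injective_iff_map_eq_zero]
  intro x hx
  obtain ⟨y, rfl⟩ := hsurj x
  have hQ : IsSelfAdjoint (algebraMap ℝ (H →L[ℂ] H) t - g) :=
    (IsSelfAdjoint.algebraMap _ (IsSelfAdjoint.all t)).sub hsa
  rw [← inner_self_eq_zero (𝕜 := ℂ), inner_apply_of_isSelfAdjoint hQ, hx, inner_zero_right]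

/-! ### Boundary values of a J-self-adjoint extension -/

theorem omegaPlus_apply (Γ : BoundaryTriplet S H) (f : S.adjoint.domain) :
    Γ.omegaPlus f = ((1 / Real.sqrt 2 : ℝ) : ℂ) • (Γ.Γ₁ f + Complex.I • Γ.Γ₀ f) := rfl

theorem omegaMinus_apply (Γ : BoundaryTriplet S H) (f : S.adjoint.domain) :
    Γ.omegaMinus f = ((1 / Real.sqrt 2 : ℝ) : ℂ) • (Γ.Γ₁ f - Complex.I • Γ.Γ₀ f) := rfl

theorem exists_omega_eq (Γ : BoundaryTriplet S H) (p q : H) :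
    ∃ f, Γ.omegaPlus f = p ∧ Γ.omegaMinus f = q := by
  -- the solution of `Γ₁ f + i Γ₀ f = √2 p`, `Γ₁ f - i Γ₀ f = √2 q`
  obtain ⟨f, h0, h1⟩ := Γ.exists_eq
    (((Real.sqrt 2 : ℝ) : ℂ) • (-(Complex.I / 2)) • (p - q))
    (((Real.sqrt 2 : ℝ) : ℂ) • (1 / 2 : ℂ) • (p + q))
  have hs : ((1 / Real.sqrt 2 : ℝ) : ℂ) * ((Real.sqrt 2 : ℝ) : ℂ) = 1 := by
    rw [← Complex.ofReal_mul, one_div_mul_cancel (by positivity), Complex.ofReal_one]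
  have hI := Complex.I_mul_I
  refine ⟨f, ?_, ?_⟩
  · rw [omegaPlus_apply, h0, h1, smul_comm Complex.I, ← smul_add, smul_smul, hs, one_smul,
      smul_smul, show Complex.I * -(Complex.I / 2) = 1 / 2 by linear_combination (-1 / 2) * hI]
    module
  · rw [omegaMinus_apply, h0, h1, smul_comm Complex.I, ← smul_sub, smul_smul, hs, one_smul,
      smul_smul, show Complex.I * -(Complex.I / 2) = 1 / 2 by linear_combination (-1 / 2) * hI]
    module

theorem inner_omegaPlus_sub (Γ : BoundaryTriplet S H) (g : H →L[ℂ] H) (x y : S.adjoint.domain) :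
    inner ℂ (Γ.omegaPlus x) (g (Γ.omegaPlus y)) - inner ℂ (Γ.omegaMinus x) (g (Γ.omegaMinus y)) =
      Complex.I *
        (inner ℂ (Γ.Γ₁ x) (g (Γ.Γ₀ y)) - inner ℂ (Γ.Γ₀ x) (g (Γ.Γ₁ y))) := by
  have hs : ((1 / Real.sqrt 2 : ℝ) : ℂ) * ((1 / Real.sqrt 2 : ℝ) : ℂ) = 1 / 2 := by
    rw [← Complex.ofReal_mul, ← sq, div_pow, Real.sq_sqrt (by norm_num)]
    norm_num
  simp only [omegaPlus_apply, omegaMinus_apply, map_smul, map_add, map_sub, inner_smul_left,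
    inner_smul_right, inner_add_left, inner_add_right, inner_sub_left, inner_sub_right,
    Complex.conj_ofReal, Complex.conj_I]
  linear_combination (2 * Complex.I * inner ℂ (Γ.Γ₁ x) (g (Γ.Γ₀ y))
    - 2 * Complex.I * inner ℂ (Γ.Γ₀ x) (g (Γ.Γ₁ y))) * hs

theorem IsImage.omega {Γ : BoundaryTriplet S H} {C : E →L[ℂ] E} {c : H →ₗ[ℂ] H}
    (hc : Γ.IsImage C c) {f g : S.adjoint.domain} (hg : (g : E) = C f) :
    c (Γ.omegaPlus f) = Γ.omegaPlus g ∧ c (Γ.omegaMinus f) = Γ.omegaMinus g := by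
  have h := hc f g hg
  simp only [omegaPlus_apply, omegaMinus_apply, map_smul, map_add, map_sub, h.1, h.2, and_self]

/-- The domain of `A` consists of the elements of `D(S*)` whose boundary values are orthogonal to
those of `D(A)`: this expresses that `A` is self-adjoint for the inner product `(J C ·, ·)`. -/
theorem mem_domain_iff {Γ : BoundaryTriplet S H} {J : E →L[ℂ] E} {A : E →ₗ.[ℂ] E}
    (hA : IsJSelfAdjoint J A) (hle : A ≤ S.adjoint) {C : E →L[ℂ] E} (hC : HasCSymmetry J A C)
    (hG : J ∘L C ∈ graphSubalgebra S.adjoint) {g : H →ₗ[ℂ] H} (hg : Γ.IsImage (J ∘L C) g)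
    (y : S.adjoint.domain) :
    (y : E) ∈ A.domain ↔ ∀ x : S.adjoint.domain, (x : E) ∈ A.domain →
      inner ℂ (Γ.Γ₁ y) (g (Γ.Γ₀ x)) = inner ℂ (Γ.Γ₀ y) (g (Γ.Γ₁ x)) := by
  obtain ⟨hAd, hdom, hval⟩ := hA
  have hcomm := hC.2.2
  have hGsa : IsSelfAdjoint (J ∘L C) := hC.isPositive.isSelfAdjoint
  constructor
  · intro hy x hx
    have hCx : C x ∈ A.domain := (hcomm.1 _).2 hx
    have hGx : J (C x) ∈ A.adjoint.domain := (hdom _).2 hCx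
    rw [← sub_eq_zero, ← hg.green hG, sub_eq_zero]
    have h := (LinearPMap.adjoint_isFormalAdjoint hAd).symm ⟨y, hy⟩ ⟨_, hGx⟩
    rw [hval ⟨_, hCx⟩ ⟨_, hGx⟩ rfl, hcomm.2 ⟨x, hx⟩ ⟨_, hCx⟩ rfl,
      hle.2 (x := ⟨y, hy⟩) (y := y) rfl, hle.2 (x := ⟨x, hx⟩) (y := x) rfl] at h
    exact h
  · intro h
    rw [← hcomm.1, ← hdom]
    refine LinearPMap.mem_adjoint_domain_of_exists _ ⟨J (C (S.adjoint y)), fun x => ?_⟩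
    have h1 := h ⟨x, hle.1 x.2⟩ x.2
    rw [← sub_eq_zero, ← hg.green hG, sub_eq_zero] at h1
    rw [hle.2 (x := x) (y := ⟨x, hle.1 x.2⟩) rfl]
    exact (inner_apply_of_isSelfAdjoint hGsa _ _).trans
      (h1.trans (inner_apply_of_isSelfAdjoint hGsa _ _).symm)

/-- The relation of all pairs `(Ω₊ f, Ω₋ f)` with `f ∈ D(A)`. -/
noncomputable def boundaryRelation (Γ : BoundaryTriplet S H) (A : E →ₗ.[ℂ] E) :
    Submodule ℂ (H × H) :=
  (A.domain.comap S.adjoint.domain.subtype).map (Γ.omegaPlus.prod Γ.omegaMinus)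

theorem mem_boundaryRelation {Γ : BoundaryTriplet S H} {A : E →ₗ.[ℂ] E} {z : H × H} :
    z ∈ Γ.boundaryRelation A ↔ ∃ f : S.adjoint.domain, (f : E) ∈ A.domain ∧
      Γ.omegaPlus f = z.1 ∧ Γ.omegaMinus f = z.2 := by
  simp [boundaryRelation, Prod.ext_iff]

theorem omega_mem_boundaryRelation_iff {Γ : BoundaryTriplet S H} {A : E →ₗ.[ℂ] E} {g : H →L[ℂ] H}
    (hA : ∀ y : S.adjoint.domain, (y : E) ∈ A.domain ↔ ∀ x : S.adjoint.domain, (x : E) ∈ A.domain →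
      inner ℂ (Γ.Γ₁ y) (g (Γ.Γ₀ x)) = inner ℂ (Γ.Γ₀ y) (g (Γ.Γ₁ x))) (y : S.adjoint.domain) :
    ((y : E) ∈ A.domain ↔ (Γ.omegaPlus y, Γ.omegaMinus y) ∈ Γ.boundaryRelation A) ∧
      ((y : E) ∈ A.domain ↔ ∀ z ∈ Γ.boundaryRelation A,
        inner ℂ (Γ.omegaPlus y) (g z.1) = inner ℂ (Γ.omegaMinus y) (g z.2)) := by
  have h2 : (y : E) ∈ A.domain ↔ ∀ z ∈ Γ.boundaryRelation A,
      inner ℂ (Γ.omegaPlus y) (g z.1) = inner ℂ (Γ.omegaMinus y) (g z.2) := by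
    have key (x : S.adjoint.domain) :
        inner ℂ (Γ.omegaPlus y) (g (Γ.omegaPlus x)) =
          inner ℂ (Γ.omegaMinus y) (g (Γ.omegaMinus x)) ↔
        inner ℂ (Γ.Γ₁ y) (g (Γ.Γ₀ x)) = inner ℂ (Γ.Γ₀ y) (g (Γ.Γ₁ x)) := by
      rw [← sub_eq_zero, inner_omegaPlus_sub, mul_eq_zero, or_iff_right Complex.I_ne_zero,
        sub_eq_zero]
    rw [hA]
    constructor
    · rintro h ⟨p, q⟩ hz
      obtain ⟨x, hx, rfl, rfl⟩ := mem_boundaryRelation.1 hz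
      exact (key x).2 (h x hx)
    · exact fun h x hx => (key x).1 (h (_, _) (mem_boundaryRelation.2 ⟨x, hx, rfl, rfl⟩))
  refine ⟨⟨fun h => mem_boundaryRelation.2 ⟨y, h, rfl, rfl⟩, fun h => ?_⟩, h2⟩
  -- an element of `D(S*)` with the boundary values of some `x ∈ D(A)` satisfies the same relations
  obtain ⟨x, hx, hp, hq⟩ := mem_boundaryRelation.1 h
  refine h2.2 fun z hz => ?_
  obtain ⟨w, hw, hw1, hw2⟩ := mem_boundaryRelation.1 hz
  have h3 := (hA x).1 hx w hw
  have h4 := Γ.inner_omegaPlus_sub g x w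
  rw [h3, sub_self, mul_zero, sub_eq_zero] at h4
  simp only at hp hq
  rwa [← hw1, ← hw2, ← hp, ← hq]

theorem eq_extension {Γ : BoundaryTriplet S H} {A : E →ₗ.[ℂ] E} (hle : A ≤ S.adjoint)
    {K : H →L[ℂ] H}
    (hK : ∀ f : S.adjoint.domain, (f : E) ∈ A.domain ↔ K (Γ.omegaPlus f) = Γ.omegaMinus f) :
    A = Γ.extension K := by
  have hdom : A.domain = (Γ.extension K).domain := by
    rw [extension, LinearPMap.domRestrict_domain]
    ext f
    simp only [Submodule.mem_inf, Submodule.mem_map, LinearMap.mem_eqLocus]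
    constructor
    · exact fun hf => ⟨⟨⟨f, hle.1 hf⟩, (hK _).1 hf, rfl⟩, hle.1 hf⟩
    · rintro ⟨⟨x, hx, rfl⟩, -⟩
      exact (hK x).2 hx
  refine LinearPMap.ext hdom fun x hx hx' => ?_
  exact (hle.2 (x := ⟨x, hx⟩) (y := ⟨x, hle.1 hx⟩) rfl).trans
    ((LinearPMap.domRestrict_le (f := S.adjoint)).2 (x := ⟨x, hx'⟩) rfl).symm

end BoundaryTriplet

end KreinExtension

open KreinExtension in
theorem theorem3p9 {E : Type*} [NormedAddCommGroup E] [InnerProductSpace ℂ E] [CompleteSpace E]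
    {H : Type*} [NormedAddCommGroup H] [InnerProductSpace ℂ H] [CompleteSpace H]
    (J : E →L[ℂ] E) (hJ : IsFundamentalSymmetry J)
    (S : E →ₗ.[ℂ] E) (hS_dense : Dense (S.domain : Set E)) (hS_symm : S.IsFormalAdjoint S)
    (hSJ : Commutes S J)
    (Γ : BoundaryTriplet S H) (hΓ : Γ.IntertwinesCSymmetries J) :
    ∃ 𝓙 : H →L[ℂ] H, IsFundamentalSymmetry 𝓙 ∧ Γ.IsImage J (𝓙 : H →ₗ[ℂ] H) ∧
      ∀ A ∈ sigmaJStable J S, ∃ K : H ≃L[ℂ] H, IsStableJUnitary 𝓙 K ∧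
        A = Γ.extension (K : H →L[ℂ] H) := by
  have hJC := mem_cSymmetries_self hJ hSJ
  have hJmem := mem_graphSubalgebra_adjoint hJ hS_dense hSJ hJC
  obtain ⟨j, hj⟩ := hΓ J hJC
  have hjs := hj.isSymmetric hJmem hJ.1
  have hjj := hj.apply_apply hJmem hJ.apply_apply
  let 𝓙 : H →L[ℂ] H := ⟨j, hjs.continuous⟩
  refine ⟨𝓙, ⟨ContinuousLinearMap.isSelfAdjoint_iff_isSymmetric.2 hjs,
    ContinuousLinearMap.ext hjj⟩, hj, ?_⟩
  rintro A ⟨hA, C, hCS, hCA⟩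
  have hle := le_adjoint_of_mem_sigmaJ hJ hS_dense hSJ hA
  have hCmem := mem_graphSubalgebra_adjoint hJ hS_dense hSJ hCS
  obtain ⟨c, hc⟩ := hΓ C hCS
  have hcc := hc.apply_apply hCmem hCS.apply_apply
  have hGmem : J ∘L C ∈ graphSubalgebra S.adjoint := mul_mem hJmem hCmem
  have hG := hj.comp hc hCmem
  have hgs := hG.isSymmetric hGmem hCS.isPositive.isSelfAdjoint
  let g : H →L[ℂ] H := ⟨j ∘ₗ c, hgs.continuous⟩
  have hg : Γ.IsImage (J ∘L C) (g : H →ₗ[ℂ] H) := hG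
  have hgx (x : H) : g x = j (c x) := rfl
  have hpos := BoundaryTriplet.isPositive_of_isImage hS_dense hg hGmem hCS.isPositive
  have hu : IsUnit g := by
    refine ContinuousLinearMap.isUnit_iff_bijective.2 ⟨fun x y h => ?_, fun x => ?_⟩
    · rw [← hcc x, ← hjj (c x), ← hgx, h, hgx, hjj, hcc]
    · exact ⟨c (j x), by rw [hgx, hcc, hjj]⟩
  have hmem := BoundaryTriplet.mem_domain_iff hA.2 hle hCA hGmem hg
  have hrel := BoundaryTriplet.omega_mem_boundaryRelation_iff hmem
  obtain ⟨K, hKL, hKg⟩ := exists_unitary_of_isHypermaximal hpos hu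
    (L := Γ.boundaryRelation A) fun p q => by
      obtain ⟨f, rfl, rfl⟩ := Γ.exists_omega_eq p q
      exact (hrel f).1.symm.trans (hrel f).2
  -- `K` commutes with `c` because `C` maps `D(A)` into itself
  have hKc (x : H) : K (c x) = c (K x) := by
    obtain ⟨f, hf, hf1, hf2⟩ := BoundaryTriplet.mem_boundaryRelation.1 ((hKL x _).2 rfl)
    simp only at hf1 hf2
    have h := hc.omega (f := f) (g := ⟨C f, apply_mem_of_mem_graphSubalgebra hCmem f.2⟩) rfl
    rw [← hf2, ← hf1, h.1, h.2]
    exact (hKL _ _).1 (BoundaryTriplet.mem_boundaryRelation.2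
      ⟨_, (hCA.2.2.1 _).2 hf, rfl, rfl⟩)
  refine ⟨K, ⟨fun x y => ?_, exists_norm_zpow_le hpos hu hKg⟩,
    BoundaryTriplet.eq_extension hle fun f => ((hrel f).1.trans (hKL _ _))⟩
  have hgc (z : H) : j z = g (c z) := by rw [hgx, hcc]
  change inner ℂ (j (K x)) (K y) = inner ℂ (j x) y
  rw [hjs, hjs, hgc, hgc, ← hKc, hKg]
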